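/- **Theorem 2 (Quantitative existence and value problems).** A probabilistic automaton consists of a finite set $Q$ of states, an initial state $q_\iota$, a finite non-empty alphabet $\Sigma$, and for each $\sigma\in\Sigma$ a transition probability matrix $M_\sigma$ on $Q$ (non-negative entries, all row sums equal to $1$); here all entries are rational, given as fractions of natural numbers. An infinite word $w=w_1w_2\cdots\in\Sigma^\omega$ induces a probability measure $\Pr^w$ on infinite state sequences $q_0q_1q_2\cdots$: one starts in $q_\iota$, and in the $n$-th step one moves from $q_{n-1}$ to $q_n$ with probability $M_{w_n}(q_{n-1},q_n)$. For a set $F\subseteq Q$ of accepting states, the acceptance probability of $w$ under the safety condition is $\mathcal A(w)=\Pr^w(\forall i\ge 0:\ q_i\in F)$. A state $q$ is absorbing if $M_\sigma(q,q)=1$ for all $\sigma\in\Sigma$; the automaton is absorbing if for every non-absorbing state $q$ and every $\sigma\in\Sigma$ there is an absorbing state $q'$ with $M_\sigma(q,q')>0$. Then the following two problems are undecidable: given an absorbing automaton $\mathcal A$ with a set $F$ of accepting states, and a rational number $0<\lambda<1$, 1. (quantitative existence problem) is there a word $w\in\Sigma^\omega$ with $\mathcal A(w)>\lambda$? 2.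 (quantitative value problem) is $\sup_{w\in\Sigma^\omega}\mathcal A(w)>\lambda$? Both problems remain undecidable when $\lambda$ is fixed to be $\tfrac18$ and only $\mathcal A$ and $F$ are given. -/

import Mathlib

open MeasureTheory ProbabilityTheory

noncomputable section

/-- A probabilistic automaton with state set `Q` and alphabet `S`: an initial state and, for every
letter, a transition probability matrix. -/
structure ProbAutomaton (Q S : Type*) [Fintype Q] where
  init : Q
  M : S → Matrix Q Q ℝ
  nonneg : ∀ s q q', 0 ≤ M s q q'
  sum_one : ∀ s q, ∑ q', M s q q' = 1

namespace ProbAutomaton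

variable {Q S : Type*} [Fintype Q] (A : ProbAutomaton Q S)

/-- The distribution of the successor of the state `q` on the letter `s`. -/
def step [MeasurableSpace Q] (s : S) (q : Q) : Measure Q :=
  ∑ q' : Q, ENNReal.ofReal (A.M s q q') • Measure.dirac q'

instance [MeasurableSpace Q] (s : S) (q : Q) : IsProbabilityMeasure (A.step s q) := by
  constructor
  simp only [step, Measure.finsetSum_apply, Measure.smul_apply, measure_univ, smul_eq_mul, mul_one]
  rw [← ENNReal.ofReal_sum_of_nonneg fun q' _ => A.nonneg s q q', A.sum_one, ENNReal.ofReal_one]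

/-- The `n`-th transition on the infinite word `w`: given the states visited at times `0, …, n`,
the state at time `n + 1` is distributed according to the row of `M (w n)` at the state visited
at time `n`. -/
def stepKernel [MeasurableSpace Q] [DiscreteMeasurableSpace Q] (w : ℕ → S) (n : ℕ) :
    Kernel (Finset.Iic n → Q) Q :=
  Kernel.ofFunOfCountable fun x => A.step (w n) (x ⟨n, Finset.mem_Iic.2 le_rfl⟩)

instance [MeasurableSpace Q] [DiscreteMeasurableSpace Q] (w : ℕ → S) (n : ℕ) :
    IsMarkovKernel (A.stepKernel w n) :=
  ⟨fun x => inferInstanceAs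
    (IsProbabilityMeasure (A.step (w n) (x ⟨n, Finset.mem_Iic.2 le_rfl⟩)))⟩

/-- The probability measure on infinite state sequences induced by the infinite word `w`. -/
def pathMeasure [MeasurableSpace Q] [DiscreteMeasurableSpace Q] (w : ℕ → S) : Measure (ℕ → Q) :=
  Kernel.traj (X := fun _ => Q) (A.stepKernel w) 0 fun _ => A.init

instance [MeasurableSpace Q] [DiscreteMeasurableSpace Q] (w : ℕ → S) :
    IsProbabilityMeasure (A.pathMeasure w) := by
  unfold pathMeasure; infer_instance

/-- The state sequences that have the first `n + 1` states in common with `p`. -/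
def cone (p : ℕ → Q) (n : ℕ) : Set (ℕ → Q) :=
  {x | ∀ i ≤ n, x i = p i}

theorem pathMeasure_cone_zero [MeasurableSpace Q] [DiscreteMeasurableSpace Q] (w : ℕ → S)
    (p : ℕ → Q) [Decidable (p 0 = A.init)] :
    A.pathMeasure w (cone p 0) = if p 0 = A.init then 1 else 0 := by
  have h := Kernel.traj_map_frestrictLe_apply (X := fun _ => Q) (κ := A.stepKernel w) 0 0
    (fun _ => A.init)
  have hc : cone p 0 = Preorder.frestrictLe (π := fun _ => Q) 0 ⁻¹' {fun i : Finset.Iic 0 => p i} := by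
    ext x
    simp only [cone, Set.mem_ofPred_eq, Set.mem_preimage, Set.mem_singleton_iff, funext_iff,
      Preorder.frestrictLe_apply, Subtype.forall, Finset.mem_Iic]
  rw [hc, ← Measure.map_apply (by fun_prop) (measurableSet_singleton _), pathMeasure, h,
    Kernel.partialTraj_self, Kernel.id_apply, Measure.dirac_apply' _ (measurableSet_singleton _)]
  by_cases hp : p 0 = A.init
  · rw [if_pos hp, Set.indicator_of_mem]
    · rfl
    · refine funext fun i => ?_
      have hi : (i : ℕ) = 0 := Nat.le_zero.1 (Finset.mem_Iic.1 i.2)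
      rw [hi, hp]
  · rw [if_neg hp, Set.indicator_of_notMem]
    intro hm
    exact hp (congrFun hm ⟨0, Finset.mem_Iic.2 le_rfl⟩).symm

theorem pathMeasure_cone_succ [MeasurableSpace Q] [DiscreteMeasurableSpace Q] (w : ℕ → S)
    (p : ℕ → Q) (n : ℕ) :
    A.pathMeasure w (cone p (n + 1)) =
      A.pathMeasure w (cone p n) * ENNReal.ofReal (A.M (w n) (p n) (p (n + 1))) := by
  have hc : cone p n = Preorder.frestrictLe (π := fun _ => Q) n ⁻¹' {fun i : Finset.Iic n => p i} := by
    ext x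
    simp only [cone, Set.mem_ofPred_eq, Set.mem_preimage, Set.mem_singleton_iff, funext_iff,
      Preorder.frestrictLe_apply, Subtype.forall, Finset.mem_Iic]
  have hc' : cone p (n + 1) =
      (fun x : ℕ → Q => (Preorder.frestrictLe (π := fun _ => Q) n x, x (n + 1))) ⁻¹'
        ({fun i : Finset.Iic n => p i} ×ˢ {p (n + 1)}) := by
    ext x
    simp only [cone, Set.mem_ofPred_eq, Set.mem_preimage, Set.mem_prod, Set.mem_singleton_iff,
      funext_iff, Preorder.frestrictLe_apply, Subtype.forall, Finset.mem_Iic, Nat.le_succ_iff]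
    constructor
    · exact fun hx => ⟨fun i hi => hx i (Or.inl hi), hx _ (Or.inr rfl)⟩
    · rintro ⟨h1, h2⟩ i (hi | rfl)
      exacts [h1 i hi, h2]
  have h := Kernel.partialTraj_compProd_eq_map_traj (X := fun _ => Q) (κ := A.stepKernel w)
    (Nat.zero_le n) (x₀ := fun _ => A.init)
  have h0 := Kernel.traj_map_frestrictLe_apply (X := fun _ => Q) (κ := A.stepKernel w) 0 n
    (fun _ => A.init)
  rw [hc, hc', ← Measure.map_apply (by fun_prop) (measurableSet_singleton _),
    ← Measure.map_apply (by fun_prop)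
      ((measurableSet_singleton _).prod (measurableSet_singleton _)),
    pathMeasure, h0, ← h, Measure.compProd_apply_prod (measurableSet_singleton _)
      (measurableSet_singleton _), lintegral_singleton, mul_comm]
  congr 1
  change A.step (w n) (p n) {p (n + 1)} = _
  rw [step, Measure.finsetSum_apply, Finset.sum_eq_single (p (n + 1))]
  · simp
  · intro q _ hq
    simp [hq]
  · simp

/-- The safety condition: the state sequences that only visit states in `F`. -/
def Safe (F : Set Q) : Set (ℕ → Q) :=
  {x | ∀ i, x i ∈ F}

/-- The acceptance probability of the infinite word `w` for the safety condition given by `F`. -/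
def safeProb [MeasurableSpace Q] [DiscreteMeasurableSpace Q] (F : Set Q) (w : ℕ → S) : ℝ :=
  (A.pathMeasure w).real (Safe F)

/-- A state is absorbing if every letter keeps it fixed with probability one. -/
def IsAbsorbingState (q : Q) : Prop :=
  ∀ s, A.M s q q = 1

/-- An automaton is absorbing if from every non-absorbing state, every letter leads to some
absorbing state with positive probability. -/
def IsAbsorbing : Prop :=
  ∀ s q, ¬ A.IsAbsorbingState q → ∃ q', A.IsAbsorbingState q' ∧ 0 < A.M s q q'

end ProbAutomaton

/-- A finite presentation of a probabilistic safety automaton with rational transition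
probabilities: states `0, …, numStates - 1`, a non-empty alphabet `0, …, numLetters - 1`,
accepting states, and the transition probabilities as fractions `num / den` (not necessarily in
lowest terms). -/
structure SafetyPresentation where
  numStates : ℕ
  numLetters : ℕ
  numLetters_pos : 0 < numLetters
  init : Fin numStates
  accept : Fin numStates → Bool
  num : Fin numLetters → Fin numStates → Fin numStates → ℕ
  den : Fin numLetters → Fin numStates → Fin numStates → ℕ
  den_pos : ∀ s q q', 0 < den s q q'
  sum_one : ∀ s q, ∑ q', (num s q q' : ℚ) / den s q q' = 1

/-- The finite data an algorithm receives: number of states, number of letters, initial state,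
accepting states, and the list of transition matrices, each given as its list of rows. -/
abbrev SafetyCode : Type :=
  ℕ × ℕ × ℕ × List Bool × List (List (List (ℕ × ℕ)))

namespace SafetyPresentation

variable (P : SafetyPresentation)

/-- The code of a presentation. -/
def code : SafetyCode :=
  (P.numStates, P.numLetters, (P.init : ℕ), List.ofFn P.accept,
    List.ofFn fun s => List.ofFn fun q => List.ofFn fun q' => (P.num s q q', P.den s q q'))

/-- The probabilistic automaton that is presented. -/
def automaton : ProbAutomaton (Fin P.numStates) (Fin P.numLetters) where
  init := P.init
  M s q q' := (P.num s q q' : ℝ) / P.den s q q'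
  nonneg s q q' := by positivity
  sum_one s q := by
    have h := congrArg (Rat.cast : ℚ → ℝ) (P.sum_one s q)
    push_cast at h
    exact h

/-- The acceptance probability of the infinite word `w`. -/
def value (w : ℕ → Fin P.numLetters) : ℝ :=
  P.automaton.safeProb {q | P.accept q = true} w

/-- The answer to the quantitative existence problem for the threshold `r`. -/
def Existence (r : ℝ) : Prop :=
  ∃ w, r < P.value w

/-- The answer to the quantitative value problem for the threshold `r`. The supremum is that of a
non-empty set of reals in `[0, 1]`. -/
def SupValue (r : ℝ) : Prop :=
  r < ⨆ w, P.value w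

end SafetyPresentation

/-- The presentations of absorbing safety automata. -/
abbrev AbsorbingSafety : Type :=
  {P : SafetyPresentation // P.automaton.IsAbsorbing}

/-- A rational number strictly between `0` and `1`, presented as a fraction. -/
structure Threshold where
  num : ℕ
  den : ℕ
  num_pos : 0 < num
  num_lt_den : num < den

/-- The real number presented by a threshold. -/
def Threshold.toReal (t : Threshold) : ℝ :=
  (t.num : ℝ) / t.den

/-- The code of a threshold. -/
def Threshold.code (t : Threshold) : ℕ × ℕ :=
  (t.num, t.den)

/-- A decision problem, given by its instances, their codes and the set of yes-instances, is
decidable if some total computable function on codes answers every instance correctly. Nothing is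
asked of the function on data that do not encode an instance. -/
def DecidableProblem {ι α : Type} [Primcodable α] (code : ι → α) (yes : ι → Prop) : Prop :=
  ∃ f : α → Bool, Computable f ∧ ∀ i, f (code i) = true ↔ yes i

end

/-!
The halting problem reduces to the question whether some word is accepted with probability greater
than `1 / 8`.

Since a transient state is left for an absorbing one with positive probability at every step, the
acceptance probability is, up to an affine rescaling, a discounted sum of rewards: a row vector is
multiplied by the matrices of the letters, and each letter pays a linear functional of the current
row vector, weighted by `D ^ (-n)` at the `n`-th step. By choice of the common denominator `D`, any
finite family of matrices over `ℕ` and of integer reward vectors can be realized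
(`RewardSystem.presentation_spec`); the rewards become a bias between the accepting and the
rejecting absorbing state.

Letters can therefore act as instructions of a register machine with linear updates, the row vector
being the vector of all products of two registers. A quadratic functional of the registers is linear
in this vector, so the validity of the equality tests of an instruction can be rewarded by minus the
sum of the squares of two linear forms. This is zero for a legal instruction and at most `-1`
otherwise, while halting pays `1` and ends the run. Because of the discount, a violation cannot be
compensated by halting later, and the total reward of some word is positive if and only if the
machine can halt (`LinearMachine.existence_iff_halts`).

Such a machine simulates a Turing machine. The halves of the tape are the digits of two registers;
pushing a digit is an affine update, and for popping one, the quotient and the remainder are guessed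
by the word and verified by an equality test (`TapeMachine.halts_iff_eval_dom`). For a fixed
universal Turing machine, only the initial registers depend on the input, and they are primitive
recursive in it (`exists_universal_machine`). So the automata have computable codes.

Finally, a supremum of reals exceeds a threshold if and only if some member does, so the value
problem is the same as the existence problem, and the threshold `1 / 8` can be passed as an input.
-/

/-! ### Finite-horizon safety probabilities -/

section Horizon

open Filter Topology

namespace ProbAutomaton

/-- The state sequences that visit only states in `F` up to time `n`. -/
def SafeUpTo {Q : Type*} (F : Set Q) (n : ℕ) : Set (ℕ → Q) :=
  {x | ∀ i ≤ n, x i ∈ F}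

theorem measurableSet_safeUpTo {Q : Type*} [MeasurableSpace Q] [DiscreteMeasurableSpace Q]
    (F : Set Q) (n : ℕ) : MeasurableSet (SafeUpTo F n) := by
  have : SafeUpTo F n = ⋂ i, ⋂ (_ : i ≤ n), (fun x : ℕ → Q => x i) ⁻¹' F := by
    ext x; simp [SafeUpTo]
  rw [this]
  exact MeasurableSet.iInter fun i => MeasurableSet.iInter fun _ =>
    (measurable_pi_apply i) (MeasurableSet.of_discrete)

theorem measurableSet_state {Q : Type*} [MeasurableSpace Q] [DiscreteMeasurableSpace Q]
    [Countable Q] (n : ℕ) (q : Q) : MeasurableSet {x : ℕ → Q | x n = q} :=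
  measurableSet_eq_fun (measurable_pi_apply n) measurable_const

variable {Q S : Type*} [Fintype Q] (A : ProbAutomaton Q S)

open Classical in
/-- The probability of visiting only states in `F` during the first `n` steps, when the automaton
is started in the state `q` and reads the word `w`. It is defined by recursion on the first
letter. -/
noncomputable def stayProb (F : Set Q) : ℕ → (ℕ → S) → Q → ℝ
  | 0, _, q => if q ∈ F then 1 else 0
  | n + 1, w, q =>
    if q ∈ F then ∑ q', A.M (w 0) q q' * stayProb F n (fun k => w (k + 1)) q' else 0

theorem stayProb_of_notMem {F : Set Q} {q : Q} (hq : q ∉ F) (n : ℕ) (w : ℕ → S) :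
    A.stayProb F n w q = 0 := by
  cases n <;> simp [stayProb, hq]

/-- The automaton `A` with the initial state replaced by `q`. -/
def startAt (q : Q) : ProbAutomaton Q S :=
  { A with init := q }

theorem stayProb_startAt (F : Set Q) (n : ℕ) (w : ℕ → S) (q p : Q) :
    (A.startAt q).stayProb F n w p = A.stayProb F n w p := by
  induction n generalizing w p with
  | zero => rfl
  | succ n ih =>
    simp only [stayProb, ih]
    rfl

section Path

variable [MeasurableSpace Q] [DiscreteMeasurableSpace Q]

/-- The Markov property: on an event that depends on the states at times `0, …, n` and prescribes
the state `q` at time `n`, the next state is `q'` with probability `M (w n) q q'`. -/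
theorem pathMeasure_inter_next (w : ℕ → S) (n : ℕ) (q q' : Q) (B : Set (Finset.Iic n → Q))
    (hB : ∀ a ∈ B, a ⟨n, Finset.mem_Iic.2 le_rfl⟩ = q) :
    A.pathMeasure w (Preorder.frestrictLe (π := fun _ => Q) n ⁻¹' B ∩ {x | x (n + 1) = q'}) =
      A.pathMeasure w (Preorder.frestrictLe (π := fun _ => Q) n ⁻¹' B) *
        ENNReal.ofReal (A.M (w n) q q') := by
  have hBm : MeasurableSet B := B.to_countable.measurableSet
  have hc : Preorder.frestrictLe (π := fun _ => Q) n ⁻¹' B ∩ {x | x (n + 1) = q'} =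
      (fun x : ℕ → Q => (Preorder.frestrictLe (π := fun _ => Q) n x, x (n + 1))) ⁻¹'
        (B ×ˢ {q'}) := by
    ext x; simp
  have h := Kernel.partialTraj_compProd_eq_map_traj (X := fun _ => Q) (κ := A.stepKernel w)
    (Nat.zero_le n) (x₀ := fun _ => A.init)
  have h0 := Kernel.traj_map_frestrictLe_apply (X := fun _ => Q) (κ := A.stepKernel w) 0 n
    (fun _ => A.init)
  have hstep : ∀ a ∈ B, A.stepKernel w n a {q'} = ENNReal.ofReal (A.M (w n) q q') := by
    intro a ha
    change A.step (w n) (a ⟨n, Finset.mem_Iic.2 le_rfl⟩) {q'} = _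
    rw [hB a ha, step, Measure.finsetSum_apply, Finset.sum_eq_single q']
    · simp
    · intro r _ hr
      simp [hr]
    · simp
  rw [hc, ← Measure.map_apply (by fun_prop) hBm,
    ← Measure.map_apply (by fun_prop) (hBm.prod (measurableSet_singleton _)),
    pathMeasure, h0, ← h, Measure.compProd_apply_prod hBm (measurableSet_singleton _),
    setLIntegral_congr_fun hBm hstep, setLIntegral_const, mul_comm]

/-- The probability of being in the state `q` at time `n`, having visited only `F`. -/
noncomputable def safeMass (F : Set Q) (w : ℕ → S) (n : ℕ) (q : Q) : ℝ :=
  (A.pathMeasure w).real (SafeUpTo F n ∩ {x | x n = q})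

theorem sum_real_inter_state (w : ℕ → S) (n : ℕ) (E : Set (ℕ → Q)) :
    ∑ q, (A.pathMeasure w).real (E ∩ {x | x n = q}) = (A.pathMeasure w).real E := by
  have hs : ∀ q, (fun x : ℕ → Q => x n) ⁻¹' {q} = {x | x n = q} := fun q => by ext; simp
  have h := sum_measure_preimage_singleton (μ := (A.pathMeasure w).restrict E)
    (Finset.univ : Finset Q) (f := fun x : ℕ → Q => x n)
    (fun y _ => hs y ▸ measurableSet_state n y)
  simp only [Measure.real]
  rw [← ENNReal.toReal_sum (fun q _ => measure_ne_top _ _)]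
  congr 1
  simp only [Finset.coe_univ, Set.preimage_univ, Measure.restrict_apply_univ] at h
  rw [← h]
  refine Finset.sum_congr rfl fun q _ => ?_
  rw [hs, Measure.restrict_apply (measurableSet_state n q), Set.inter_comm]

open Classical in
theorem safeMass_zero (F : Set Q) (w : ℕ → S) (q : Q) :
    A.safeMass F w 0 q = if q ∈ F ∧ q = A.init then 1 else 0 := by
  have h := A.pathMeasure_cone_zero w (fun _ => q)
  by_cases hq : q ∈ F
  · have hs : SafeUpTo F 0 ∩ {x : ℕ → Q | x 0 = q} = cone (fun _ => q) 0 := by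
      ext x
      simp only [SafeUpTo, cone, Set.mem_inter_iff, Set.mem_ofPred_eq, Nat.le_zero, forall_eq]
      exact ⟨fun h => h.2, fun h => ⟨h ▸ hq, h⟩⟩
    rw [safeMass, hs, Measure.real, h]
    by_cases hi : q = A.init <;> simp [hi, hq]
    simpa [hi] using hq
  · have hs : SafeUpTo F 0 ∩ {x : ℕ → Q | x 0 = q} = ∅ := by
      ext x
      simp only [SafeUpTo, Set.mem_inter_iff, Set.mem_ofPred_eq, Nat.le_zero, forall_eq,
        Set.mem_empty_iff_false, iff_false]
      exact fun h => hq (h.2 ▸ h.1)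
    simp [safeMass, hs, hq]

open Classical in
theorem safeMass_succ (F : Set Q) (w : ℕ → S) (n : ℕ) (q' : Q) :
    A.safeMass F w (n + 1) q' =
      if q' ∈ F then ∑ q, A.safeMass F w n q * A.M (w n) q q' else 0 := by
  by_cases hq : q' ∈ F
  · have hs : SafeUpTo F (n + 1) ∩ {x : ℕ → Q | x (n + 1) = q'} =
        SafeUpTo F n ∩ {x : ℕ → Q | x (n + 1) = q'} := by
      ext x
      simp only [SafeUpTo, Set.mem_inter_iff, Set.mem_ofPred_eq, and_congr_left_iff]
      refine fun hx => ⟨fun h i hi => h i (hi.trans n.le_succ), fun h i hi => ?_⟩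
      rcases Nat.le_succ_iff.1 hi with hi | rfl
      exacts [h i hi, hx ▸ hq]
    rw [if_pos hq, safeMass, hs, ← A.sum_real_inter_state w n]
    refine Finset.sum_congr rfl fun q _ => ?_
    let B : Set (Finset.Iic n → Q) :=
      {a | (∀ i, a i ∈ F) ∧ a ⟨n, Finset.mem_Iic.2 le_rfl⟩ = q}
    have hB : Preorder.frestrictLe (π := fun _ => Q) n ⁻¹' B = SafeUpTo F n ∩ {x | x n = q} := by
      ext x
      simp [B, SafeUpTo]
    have h := A.pathMeasure_inter_next w n q q' B fun a ha => ha.2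
    rw [hB] at h
    rw [safeMass, Measure.real, Measure.real,
      show SafeUpTo F n ∩ {x : ℕ → Q | x (n + 1) = q'} ∩ {x | x n = q} =
        SafeUpTo F n ∩ {x | x n = q} ∩ {x | x (n + 1) = q'} by ext; simp; tauto, h,
      ENNReal.toReal_mul, ENNReal.toReal_ofReal (A.nonneg _ _ _)]
  · have hs : SafeUpTo F (n + 1) ∩ {x : ℕ → Q | x (n + 1) = q'} = ∅ := by
      ext x
      simp only [SafeUpTo, Set.mem_inter_iff, Set.mem_ofPred_eq, Set.mem_empty_iff_false,
        iff_false]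
      exact fun h => hq (h.2 ▸ h.1 _ le_rfl)
    simp [safeMass, hs, hq]

theorem safeMass_of_notMem {F : Set Q} {q : Q} (hq : q ∉ F) (w : ℕ → S) (n : ℕ) :
    A.safeMass F w n q = 0 := by
  cases n
  · simp [safeMass_zero, hq]
  · simp [safeMass_succ, hq]

/-- Splitting the first `n + k` steps into the first `n` and the following `k` ones. -/
theorem sum_safeMass_mul_stayProb (F : Set Q) (w : ℕ → S) (k n : ℕ) :
    ∑ q, A.safeMass F w n q * A.stayProb F k (fun i => w (n + i)) q =
      (A.pathMeasure w).real (SafeUpTo F (n + k)) := by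
  induction k generalizing n with
  | zero =>
    rw [Nat.add_zero, ← A.sum_real_inter_state w n]
    refine Finset.sum_congr rfl fun q _ => ?_
    by_cases hq : q ∈ F
    · simp [stayProb, hq, safeMass]
    · simpa [hq, safeMass, stayProb] using (A.safeMass_of_notMem hq w n).symm
  | succ k ih =>
    rw [← Nat.add_assoc, Nat.add_right_comm, ← ih (n + 1)]
    have hl : ∀ q, A.safeMass F w n q * A.stayProb F (k + 1) (fun i => w (n + i)) q =
        ∑ q', A.safeMass F w n q * A.M (w n) q q' *
          A.stayProb F k (fun i => w (n + 1 + i)) q' := by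
      intro q
      by_cases hq : q ∈ F
      · simp only [stayProb, hq, if_true, Nat.add_zero, Finset.mul_sum, mul_assoc, Nat.add_assoc,
          Nat.add_comm 1]
      · simp [A.safeMass_of_notMem hq]
    rw [Finset.sum_congr rfl fun q _ => hl q, Finset.sum_comm]
    refine Finset.sum_congr rfl fun q' _ => ?_
    by_cases hq : q' ∈ F
    · rw [safeMass_succ, if_pos hq, Finset.sum_mul]
    · simp [A.stayProb_of_notMem hq]

theorem stayProb_init (F : Set Q) (w : ℕ → S) (n : ℕ) :
    A.stayProb F n w A.init = (A.pathMeasure w).real (SafeUpTo F n) := by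
  have h := A.sum_safeMass_mul_stayProb F w n 0
  rw [Nat.zero_add] at h
  rw [← h, Finset.sum_eq_single A.init]
  · by_cases hq : A.init ∈ F
    · simp [safeMass_zero, hq]
    · simp [A.stayProb_of_notMem hq]
  · intro q _ hq
    simp [safeMass_zero, hq]
  · simp

/-- The acceptance probability for the safety condition is the limit of the probabilities of being
safe up to time `n`, which satisfy the recursion defining `stayProb`. -/
theorem tendsto_stayProb (F : Set Q) (w : ℕ → S) :
    Tendsto (fun n => A.stayProb F n w A.init) atTop (𝓝 (A.safeProb F w)) := by
  have hS : Safe F = ⋂ n, SafeUpTo F n := by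
    ext x
    simp only [Safe, SafeUpTo, Set.mem_ofPred_eq, Set.mem_iInter]
    exact ⟨fun h n i _ => h i, fun h i => h i i le_rfl⟩
  simp only [stayProb_init, safeProb, hS]
  have h := tendsto_measure_iInter_atTop (μ := A.pathMeasure w) (s := SafeUpTo F)
    (fun n => (measurableSet_safeUpTo F n).nullMeasurableSet)
    (fun m n hmn x hx i hi => hx i (hi.trans hmn)) ⟨0, measure_ne_top _ _⟩
  exact (ENNReal.tendsto_toReal (measure_ne_top _ _)).comp h

theorem tendsto_stayProb_startAt (F : Set Q) (w : ℕ → S) (q : Q) :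
    Tendsto (fun n => A.stayProb F n w q) atTop (𝓝 ((A.startAt q).safeProb F w)) :=
  ((A.startAt q).tendsto_stayProb F w).congr fun n => A.stayProb_startAt F n w q q

end Path

end ProbAutomaton

end Horizon

/-! ### Discounted rewards as acceptance probabilities -/

section Rewards

open Filter Topology

/-- A weighted transition system with states `I` and letters `S`: every letter `s` carries a
matrix `T s` of natural numbers, by which row vectors are transformed, and a vector `r s` of
integers, whose product with the current row vector is the reward for reading `s`. -/
structure RewardSystem (S I : Type) where
  T : S → I → I → ℕ
  r : S → I → ℤ

namespace RewardSystem

variable {S I : Type} [Fintype S] [Fintype I] (R : RewardSystem S I)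

/-- A common denominator that makes all rows of all matrices strictly substochastic, with room
left for the rewards. -/
def scale : ℕ :=
  2 + ∑ s, ∑ i, (∑ j, R.T s i j + (R.r s i).natAbs)

theorem row_add_two_le_scale (s : S) (i : I) :
    ∑ j, R.T s i j + (R.r s i).natAbs + 2 ≤ R.scale := by
  have h1 := Finset.single_le_sum (f := fun i => ∑ j, R.T s i j + (R.r s i).natAbs)
    (fun _ _ => Nat.zero_le _) (Finset.mem_univ i)
  have h2 := Finset.single_le_sum (f := fun s => ∑ i, (∑ j, R.T s i j + (R.r s i).natAbs))
    (fun _ _ => Nat.zero_le _) (Finset.mem_univ s)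
  rw [scale]
  exact (Nat.add_comm _ _).trans_le (Nat.add_le_add_left (h1.trans h2) 2)

theorem two_le_scale : 2 ≤ R.scale := by
  simp [scale]

/-- The states of the automaton that realizes a reward system: `none` is the initial state,
`some (inl true)` and `some (inl false)` are the accepting and the rejecting absorbing state, and
`some (inr i)` is the state `i` of the system. -/
abbrev Node (I : Type) : Type :=
  Option (Bool ⊕ I)

/-- Numerators of the transition probabilities. The automaton leaves the initial state with
probabilities proportional to `Y`, `1 / 8` in total. With the probability `1 / 16` of accepting at
once, this makes the acceptance probability exactly `1 / 8` if the total reward is zero: without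
rewards, the states of the system accept and reject with equal probability. In a state `i` of the
system, the rewards are turned into a bias towards accepting over rejecting. -/
def nodeNum (Y : I → ℕ) (s : S) : Node I → Node I → ℕ
  | _, none => 0
  | none, some (Sum.inl true) => ∑ i, Y i
  | none, some (Sum.inl false) => 13 * ∑ i, Y i
  | none, some (Sum.inr j) => 2 * Y j
  | some (Sum.inl b), some (Sum.inl b') => if b = b' then 1 else 0
  | some (Sum.inl _), some (Sum.inr _) => 0
  | some (Sum.inr i), some (Sum.inl true) => (R.scale - ∑ j, (R.T s i j : ℤ) + R.r s i).toNat
  | some (Sum.inr i), some (Sum.inl false) => (R.scale - ∑ j, (R.T s i j : ℤ) - R.r s i).toNat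
  | some (Sum.inr i), some (Sum.inr j) => 2 * R.T s i j

/-- Denominators of the transition probabilities. -/
def nodeDen (Y : I → ℕ) : Node I → ℕ
  | none => 16 * ∑ i, Y i
  | some (Sum.inl _) => 1
  | some (Sum.inr _) => 2 * R.scale

theorem toNat_accept (s : S) (i : I) :
    (((R.scale - ∑ j, (R.T s i j : ℤ) + R.r s i).toNat : ℕ) : ℤ) =
      R.scale - ∑ j, (R.T s i j : ℤ) + R.r s i := by
  have h := R.row_add_two_le_scale s i
  zify at h
  have := neg_abs_le (R.r s i)
  exact Int.toNat_of_nonneg (by linarith)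

theorem toNat_reject (s : S) (i : I) :
    (((R.scale - ∑ j, (R.T s i j : ℤ) - R.r s i).toNat : ℕ) : ℤ) =
      R.scale - ∑ j, (R.T s i j : ℤ) - R.r s i := by
  have h := R.row_add_two_le_scale s i
  zify at h
  have := le_abs_self (R.r s i)
  exact Int.toNat_of_nonneg (by linarith)

theorem sum_nodeNum (Y : I → ℕ) (s : S) (q : Node I) :
    ∑ q', R.nodeNum Y s q q' = R.nodeDen Y q := by
  zify
  rcases q with _ | b | i
  · simp only [nodeNum, nodeDen, Fintype.sum_option, Fintype.sum_sum_type, Fintype.sum_bool]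
    push_cast
    rw [← Finset.mul_sum]
    ring
  · cases b <;> simp [nodeNum, nodeDen, Fintype.sum_option, Fintype.sum_sum_type]
  · simp only [nodeNum, nodeDen, Fintype.sum_option, Fintype.sum_sum_type, Fintype.sum_bool,
      toNat_accept, toNat_reject]
    push_cast
    rw [← Finset.mul_sum]
    ring

theorem nodeDen_pos {Y : I → ℕ} (hY : 0 < ∑ i, Y i) (q : Node I) : 0 < R.nodeDen Y q := by
  have := R.two_le_scale
  rcases q with _ | b | i <;> simp only [nodeDen] <;> omega

/-- The states of the automaton, numbered. -/
noncomputable def stateEquiv (I : Type) [Fintype I] : Node I ≃ Fin (Fintype.card (Node I)) :=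
  Fintype.equivFin _

/-- The letters of the automaton, numbered. -/
noncomputable def letterEquiv (S : Type) [Fintype S] : S ≃ Fin (Fintype.card S) :=
  Fintype.equivFin _

/-- The probabilistic safety automaton that realizes the reward system `R`, started with the row
vector `Y`. -/
noncomputable def presentation [Nonempty S] (Y : I → ℕ) (hY : 0 < ∑ i, Y i) :
    SafetyPresentation where
  numStates := Fintype.card (Node I)
  numLetters := Fintype.card S
  numLetters_pos := Fintype.card_pos
  init := stateEquiv I none
  accept q := (stateEquiv I).symm q |>.elim true (Sum.elim id fun _ => true)
  num s q q' := R.nodeNum Y ((letterEquiv S).symm s) ((stateEquiv I).symm q)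
    ((stateEquiv I).symm q')
  den _ q _ := R.nodeDen Y ((stateEquiv I).symm q)
  den_pos _ _ _ := R.nodeDen_pos hY _
  sum_one s q := by
    have h := R.sum_nodeNum Y ((letterEquiv S).symm s) ((stateEquiv I).symm q)
    have hd := R.nodeDen_pos hY ((stateEquiv I).symm q)
    rw [← Finset.sum_div, (stateEquiv I).symm.sum_comp
      (fun q' => (R.nodeNum Y ((letterEquiv S).symm s) ((stateEquiv I).symm q) q' : ℚ)),
      ← Nat.cast_sum, h, div_self (by positivity)]

section

variable [Nonempty S] {Y : I → ℕ} (hY : 0 < ∑ i, Y i)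

/-- The numbering of the states, with the type required by the presentation. -/
noncomputable def stateNumbering : Node I ≃ Fin (R.presentation Y hY).numStates :=
  stateEquiv I

/-- The numbering of the letters, with the type required by the presentation. -/
noncomputable def letterNumbering : S ≃ Fin (R.presentation Y hY).numLetters :=
  letterEquiv S

theorem presentation_M (s : S) (q q' : Node I) :
    (R.presentation Y hY).automaton.M (R.letterNumbering hY s) (R.stateNumbering hY q)
        (R.stateNumbering hY q') =
      (R.nodeNum Y s q q' : ℝ) / R.nodeDen Y q := by
  change (R.nodeNum Y ((letterEquiv S).symm (letterEquiv S s))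
    ((stateEquiv I).symm (stateEquiv I q)) ((stateEquiv I).symm (stateEquiv I q')) : ℝ) /
      R.nodeDen Y ((stateEquiv I).symm (stateEquiv I q)) = _
  simp only [Equiv.symm_apply_apply]

theorem isAbsorbingState_inl (b : Bool) :
    (R.presentation Y hY).automaton.IsAbsorbingState (R.stateNumbering hY (some (Sum.inl b))) := by
  intro s
  obtain ⟨s, rfl⟩ := (R.letterNumbering hY).surjective s
  rw [presentation_M]
  simp [nodeNum, nodeDen]

theorem presentation_isAbsorbing : (R.presentation Y hY).automaton.IsAbsorbing := by
  intro s q hq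
  refine ⟨_, R.isAbsorbingState_inl hY true, ?_⟩
  obtain ⟨s, rfl⟩ := (R.letterNumbering hY).surjective s
  obtain ⟨q, rfl⟩ := (R.stateNumbering hY).surjective q
  rw [presentation_M]
  refine div_pos (Nat.cast_pos.2 ?_) (Nat.cast_pos.2 (R.nodeDen_pos hY q))
  rcases q with _ | b | i
  · exact hY
  · exact absurd (R.isAbsorbingState_inl hY b) hq
  · simp only [nodeNum]
    have h := R.row_add_two_le_scale s i
    zify at h ⊢
    have := neg_abs_le (R.r s i)
    rw [toNat_accept]
    linarith

/-- The set of accepting states of the automaton. -/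
noncomputable abbrev good : Set (Fin (R.presentation Y hY).numStates) :=
  {q | (R.presentation Y hY).accept q = true}

/-- `stayProb` for the automaton, as a function of nodes and of words over the original
alphabet. -/
noncomputable def stay (n : ℕ) (w : ℕ → S) (q : Node I) : ℝ :=
  (R.presentation Y hY).automaton.stayProb (R.good hY) n (fun k => R.letterNumbering hY (w k))
    (R.stateNumbering hY q)

theorem mem_good (q : Node I) : R.stateNumbering hY q ∈ R.good hY ↔ q ≠ some (Sum.inl false) := by
  change ((stateEquiv I).symm (stateEquiv I q) |>.elim true (Sum.elim id fun _ => true)) = true ↔ _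
  rw [Equiv.symm_apply_apply]
  rcases q with _ | (_ | _) | i <;> simp

theorem stay_zero (w : ℕ → S) {q : Node I} (hq : q ≠ some (Sum.inl false)) :
    R.stay hY 0 w q = 1 := by
  simp only [stay, ProbAutomaton.stayProb]
  rw [if_pos ((R.mem_good hY q).2 hq)]

theorem stay_succ (n : ℕ) (w : ℕ → S) {q : Node I} (hq : q ≠ some (Sum.inl false)) :
    R.stay hY (n + 1) w q =
      ∑ q', (R.nodeNum Y (w 0) q q' : ℝ) / R.nodeDen Y q *
        R.stay hY n (fun k => w (k + 1)) q' := by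
  simp only [stay, ProbAutomaton.stayProb]
  rw [if_pos ((R.mem_good hY q).2 hq)]
  refine ((R.stateNumbering hY).sum_comp _).symm.trans (Finset.sum_congr rfl fun q' _ => ?_)
  rw [presentation_M]

theorem stay_reject (n : ℕ) (w : ℕ → S) : R.stay hY n w (some (Sum.inl false)) = 0 :=
  ProbAutomaton.stayProb_of_notMem _ (fun h => (R.mem_good hY _).1 h rfl) _ _

theorem stay_accept (n : ℕ) (w : ℕ → S) : R.stay hY n w (some (Sum.inl true)) = 1 := by
  induction n generalizing w with
  | zero => exact R.stay_zero hY w (by simp)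
  | succ n ih =>
    rw [stay_succ _ _ _ _ (by simp)]
    simp [Fintype.sum_option, Fintype.sum_sum_type, nodeNum, nodeDen, ih]

theorem stay_inner_succ (n : ℕ) (w : ℕ → S) (i : I) :
    2 * R.stay hY (n + 1) w (some (Sum.inr i)) - 1 =
      (∑ j, (R.T (w 0) i j : ℝ) *
        (2 * R.stay hY n (fun k => w (k + 1)) (some (Sum.inr j)) - 1) + R.r (w 0) i) /
          R.scale := by
  have hD : (R.scale : ℝ) ≠ 0 := by have := R.two_le_scale; positivity
  have ha : (((R.scale - ∑ j, (R.T (w 0) i j : ℤ) + R.r (w 0) i).toNat : ℕ) : ℝ) =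
      R.scale - ∑ j, (R.T (w 0) i j : ℝ) + R.r (w 0) i := by
    exact_mod_cast congrArg (Int.cast : ℤ → ℝ) (R.toNat_accept (w 0) i)
  rw [stay_succ _ _ _ _ (by simp)]
  simp only [Fintype.sum_option, Fintype.sum_sum_type, Fintype.sum_bool, nodeNum, nodeDen,
    stay_accept, stay_reject, ha]
  push_cast
  simp only [mul_sub, mul_one, Finset.sum_sub_distrib, div_mul_eq_mul_div]
  rw [← Finset.sum_div]
  simp only [mul_assoc, mul_left_comm _ (2 : ℝ), ← Finset.mul_sum]
  field_simp
  ring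

theorem stay_start_succ (n : ℕ) (w : ℕ → S) :
    R.stay hY (n + 1) w none =
      1 / 8 + (∑ i, (Y i : ℝ) * (2 * R.stay hY n (fun k => w (k + 1)) (some (Sum.inr i)) - 1)) /
        (16 * ∑ i, (Y i : ℝ)) := by
  have hD : (∑ i, (Y i : ℝ)) ≠ 0 := by exact_mod_cast hY.ne'
  rw [stay_succ _ _ _ _ (by simp)]
  simp only [Fintype.sum_option, Fintype.sum_sum_type, Fintype.sum_bool, nodeNum, nodeDen,
    stay_accept, stay_reject]
  push_cast
  simp only [mul_sub, mul_one, Finset.sum_sub_distrib, div_mul_eq_mul_div]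
  rw [← Finset.sum_div]
  simp only [mul_assoc, mul_left_comm _ (2 : ℝ), ← Finset.mul_sum]
  field_simp
  ring

/-- The acceptance probability when the automaton is started in the node `q`. -/
noncomputable def valueFrom (w : ℕ → S) (q : Node I) : ℝ :=
  ((R.presentation Y hY).automaton.startAt (R.stateNumbering hY q)).safeProb (R.good hY)
    (fun k => R.letterNumbering hY (w k))

theorem tendsto_stay (w : ℕ → S) (q : Node I) :
    Tendsto (fun n => R.stay hY n w q) atTop (𝓝 (R.valueFrom hY w q)) :=
  (R.presentation Y hY).automaton.tendsto_stayProb_startAt _ _ _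

theorem valueFrom_mem_Icc (w : ℕ → S) (q : Node I) : R.valueFrom hY w q ∈ Set.Icc (0 : ℝ) 1 :=
  ⟨MeasureTheory.measureReal_nonneg, MeasureTheory.measureReal_le_one⟩

/-- The discounted total reward `X w i` that the word `w` collects from the state `i` satisfies the
recursion below, and the automaton accepts some word with probability greater than `1 / 8` if and
only if some word collects a positive total reward from the row vector `Y`. -/
theorem presentation_spec :
    ∃ X : (ℕ → S) → I → ℝ,
      (∀ w i, |X w i| ≤ 1) ∧
      (∀ w i, X w i =
        (∑ j, (R.T (w 0) i j : ℝ) * X (fun k => w (k + 1)) j + R.r (w 0) i) / R.scale) ∧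
      ((R.presentation Y hY).Existence (1 / 8) ↔ ∃ w, 0 < ∑ i, (Y i : ℝ) * X w i) := by
  refine ⟨fun w i => 2 * R.valueFrom hY w (some (Sum.inr i)) - 1, fun w i => ?_, fun w i => ?_, ?_⟩
  · have := R.valueFrom_mem_Icc hY w (some (Sum.inr i))
    rw [abs_le]
    constructor <;> linarith [this.1, this.2]
  · refine tendsto_nhds_unique (((R.tendsto_stay hY w _).comp (tendsto_add_atTop_nat 1)).const_mul 2
      |>.sub_const 1) ?_
    simp only [Function.comp_def, stay_inner_succ]
    refine Tendsto.div_const (Tendsto.add_const _ (tendsto_finsetSum _ fun j _ => ?_)) _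
    exact (((R.tendsto_stay hY _ _).const_mul 2).sub_const 1).const_mul _
  · have hval : ∀ w : ℕ → S, R.valueFrom hY w none =
        1 / 8 + (∑ i, (Y i : ℝ) *
          (2 * R.valueFrom hY (fun k => w (k + 1)) (some (Sum.inr i)) - 1)) /
            (16 * ∑ i, (Y i : ℝ)) := by
      intro w
      refine tendsto_nhds_unique ((R.tendsto_stay hY w _).comp (tendsto_add_atTop_nat 1)) ?_
      simp only [Function.comp_def, stay_start_succ]
      refine Tendsto.const_add _ (Tendsto.div_const (tendsto_finsetSum _ fun j _ => ?_) _)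
      exact (((R.tendsto_stay hY _ _).const_mul 2).sub_const 1).const_mul _
    have hpos : (0 : ℝ) < 16 * ∑ i, (Y i : ℝ) := by
      have : (0 : ℝ) < ∑ i, (Y i : ℝ) := by exact_mod_cast hY
      positivity
    have hv : ∀ w : ℕ → S, (R.presentation Y hY).value (fun k => R.letterNumbering hY (w k)) =
        R.valueFrom hY w none := fun _ => rfl
    constructor
    · rintro ⟨w, hw⟩
      obtain ⟨u, rfl⟩ : ∃ u : ℕ → S, w = fun k => R.letterNumbering hY (u k) :=
        ⟨fun k => (R.letterNumbering hY).symm (w k), by simp⟩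
      rw [hv, hval, lt_add_iff_pos_right] at hw
      exact ⟨fun k => u (k + 1), (div_pos_iff_of_pos_right hpos).1 hw⟩
    · rintro ⟨w, hw⟩
      obtain ⟨a⟩ := ‹Nonempty S›
      -- the first letter is irrelevant, it is consumed by the initial state
      let u : ℕ → S := fun k => Nat.casesOn k a w
      refine ⟨fun k => R.letterNumbering hY (u k), ?_⟩
      rw [hv, hval, lt_add_iff_pos_right]
      exact div_pos hw hpos

end

theorem primrec_sum {α ι : Type*} [Primcodable α] (s : Finset ι) {f : α → ι → ℕ}
    (hf : ∀ i, Primrec fun a => f a i) : Primrec fun a => ∑ i ∈ s, f a i := by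
  classical
  induction s using Finset.induction_on with
  | empty => simpa using Primrec.const 0
  | insert i s hi ih =>
    simp only [Finset.sum_insert hi]
    exact Primrec.nat_add.comp (hf i) ih

/-- The code of the automaton depends on the initial row vector in a primitive recursive way. -/
theorem primrec_presentation_code [Nonempty S] {Y : ℕ → I → ℕ} (hY : ∀ n, 0 < ∑ i, Y n i)
    (hp : ∀ i, Primrec fun n => Y n i) :
    Primrec fun n => (R.presentation (Y n) (hY n)).code := by
  have hsum := primrec_sum Finset.univ hp
  have hnum : ∀ s q q', Primrec fun n => R.nodeNum (Y n) s q q' := by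
    intro s q q'
    rcases q with _ | b | i <;> rcases q' with _ | (_ | _) | j <;> simp only [nodeNum] <;>
      first
        | exact Primrec.const _
        | exact hsum
        | exact Primrec.nat_mul.comp (Primrec.const _) hsum
        | exact Primrec.nat_mul.comp (Primrec.const _) (hp j)
  have hden : ∀ q, Primrec fun n => R.nodeDen (Y n) q := by
    intro q
    rcases q with _ | b | i <;> simp only [nodeDen] <;>
      first
        | exact Primrec.const _
        | exact Primrec.nat_mul.comp (Primrec.const _) hsum
  refine (Primrec.pair (Primrec.const (Fintype.card (Node I)))
    (Primrec.pair (Primrec.const (Fintype.card S)) (Primrec.pair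
    (Primrec.const (stateEquiv I none : ℕ)) (Primrec.pair (Primrec.const (List.ofFn fun q =>
      ((stateEquiv I).symm q |>.elim true (Sum.elim id fun _ => true))))
    (Primrec.list_ofFn fun s => Primrec.list_ofFn fun q => Primrec.list_ofFn fun q' =>
      Primrec.pair (hnum ((letterEquiv S).symm s) ((stateEquiv I).symm q)
        ((stateEquiv I).symm q')) (hden ((stateEquiv I).symm q))))))).of_eq fun n => rfl

end RewardSystem

end Rewards

/-! ### Linear register machines -/

section Machines

open Filter Topology

/-- A nondeterministic register machine with registers `ι` in `ℕ`. Its instructions `S` update the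
registers linearly; an instruction is legal if two linear forms vanish. The register `one` is
constantly one, so that affine updates and tests are available. Some instructions are halting. -/
structure LinearMachine (S ι : Type) where
  upd : S → ι → ι → ℕ
  test : S → Fin 2 → ι → ℤ
  halt : S → Bool
  one : ι

namespace LinearMachine

variable {S ι : Type} [Fintype ι] (L : LinearMachine S ι)

/-- The registers after the execution of `s`. -/
def next (s : S) (y : ι → ℕ) (j : ι) : ℕ :=
  ∑ i, y i * L.upd s i j

/-- The value of the `k`-th linear form that has to vanish for `s` to be legal. -/
def testValue (s : S) (y : ι → ℕ) (k : Fin 2) : ℤ :=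
  ∑ i, y i * L.test s k i

/-- The instruction `s` may be executed when the registers are `y`. -/
def Legal (s : S) (y : ι → ℕ) : Prop :=
  ∀ k, L.testValue s y k = 0

/-- Some sequence of legal instructions starting from the registers `y` ends with a halting
instruction. -/
inductive Halts : (ι → ℕ) → Prop
  | halt {s y} : L.Legal s y → L.halt s = true → Halts y
  | step {s y} : L.Legal s y → L.halt s = false → Halts (L.next s y) → Halts y

open Classical in
/-- The reward system that runs the machine on the rank one matrix of all products of two
registers. Violations of the tests are punished by the sum of the squares of the two linear forms,
halting is rewarded by one, and all weight is lost after halting. -/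
noncomputable def rewards : RewardSystem S (ι × ι) where
  T s p q := if L.halt s then 0 else L.upd s p.1 q.1 * L.upd s p.2 q.2
  r s p := (if L.halt s = true ∧ p = (L.one, L.one) then 1 else 0) -
    ∑ k, L.test s k p.1 * L.test s k p.2

/-- The rank one matrix of all products of two registers. -/
def square (y : ι → ℕ) (p : ι × ι) : ℕ :=
  y p.1 * y p.2

theorem sum_square (y : ι → ℕ) : ∑ p, square y p = (∑ i, y i) * ∑ i, y i := by
  simp [square, Fintype.sum_prod_type, Finset.sum_mul_sum]

theorem sum_square_mul_T (s : S) (y : ι → ℕ) (q : ι × ι) :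
    ∑ p, square y p * L.rewards.T s p q = if L.halt s then 0 else square (L.next s y) q := by
  by_cases h : L.halt s = true
  · simp [rewards, h]
  · simp only [rewards, h, square, next, Fintype.sum_prod_type, Finset.sum_mul_sum]
    exact Finset.sum_congr rfl fun i _ => Finset.sum_congr rfl fun j _ => by
      simp only [Bool.false_eq_true, if_false]
      ring

theorem sum_square_mul_r (s : S) (y : ι → ℕ) :
    ∑ p, (square y p : ℤ) * L.rewards.r s p =
      (if L.halt s then (y L.one : ℤ) ^ 2 else 0) - ∑ k, L.testValue s y k ^ 2 := by
  classical
  simp only [rewards, mul_sub, Finset.sum_sub_distrib]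
  congr 1
  · by_cases h : L.halt s = true
    · simp [h, square, pow_two]
    · simp [h]
  · simp only [Finset.mul_sum]
    rw [Finset.sum_comm]
    refine Finset.sum_congr rfl fun k _ => ?_
    simp only [testValue, pow_two, Finset.sum_mul_sum, Fintype.sum_prod_type, square]
    exact Finset.sum_congr rfl fun i _ => Finset.sum_congr rfl fun j _ => by
      push_cast
      ring

theorem total_succ [Fintype S] {X : (ℕ → S) → ι × ι → ℝ}
    (hX : ∀ w i, X w i = (∑ j, (L.rewards.T (w 0) i j : ℝ) * X (fun k => w (k + 1)) j +
      L.rewards.r (w 0) i) / L.rewards.scale)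
    (y : ι → ℕ) (w : ℕ → S) :
    ∑ p, (square y p : ℝ) * X w p =
      ((if L.halt (w 0) then (y L.one : ℝ) ^ 2 else 0) - ∑ k, (L.testValue (w 0) y k : ℝ) ^ 2 +
        (if L.halt (w 0) then 0 else
          ∑ p, (square (L.next (w 0) y) p : ℝ) * X (fun k => w (k + 1)) p)) /
        L.rewards.scale := by
  have h1 := congrArg (Int.cast : ℤ → ℝ) (L.sum_square_mul_r (w 0) y)
  have h2 : ∑ p, (square y p : ℝ) * ∑ q, (L.rewards.T (w 0) p q : ℝ) * X (fun k => w (k + 1)) q =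
      if L.halt (w 0) then 0 else
          ∑ p, (square (L.next (w 0) y) p : ℝ) * X (fun k => w (k + 1)) p := by
    simp only [Finset.mul_sum, ← mul_assoc]
    rw [Finset.sum_comm]
    simp only [← Finset.sum_mul]
    have h3 := fun q => congrArg (Nat.cast : ℕ → ℝ) (L.sum_square_mul_T (w 0) y q)
    push_cast at h3
    simp only [h3]
    by_cases h : L.halt (w 0) = true <;> simp [h]
  rw [Finset.sum_congr rfl fun p _ => by rw [hX w p]]
  push_cast at h1
  simp only [mul_div_assoc', mul_add, ← Finset.sum_div, Finset.sum_add_distrib, h1, h2]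
  rw [add_comm]

theorem total_le {X : (ℕ → S) → ι × ι → ℝ}
    (hb : ∀ w i, |X w i| ≤ 1) (y : ι → ℕ) (w : ℕ → S) :
    ∑ p, (square y p : ℝ) * X w p ≤ ((∑ p, square y p : ℕ) : ℝ) := by
  push_cast
  exact Finset.sum_le_sum fun p _ =>
    mul_le_of_le_one_right (Nat.cast_nonneg _) ((abs_le.1 (hb w p)).2)

theorem sum_square_next_le [Fintype S] {s : S} (hs : L.halt s = false) (y : ι → ℕ) :
    ((∑ p, square (L.next s y) p : ℕ) : ℝ) ≤
      (L.rewards.scale - 1) * ((∑ p, square y p : ℕ) : ℝ) := by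
  have h1 : ∑ q, square (L.next s y) q = ∑ p, square y p * ∑ q, L.rewards.T s p q := by
    simp only [Finset.mul_sum]
    rw [Finset.sum_comm]
    refine Finset.sum_congr rfl fun q _ => ?_
    rw [sum_square_mul_T, hs]
    rfl
  rw [h1]
  push_cast
  rw [Finset.mul_sum]
  refine Finset.sum_le_sum fun p _ => ?_
  rw [mul_comm]
  refine mul_le_mul_of_nonneg_right ?_ (Nat.cast_nonneg _)
  have h := L.rewards.row_add_two_le_scale s p
  have h' : ∑ q, L.rewards.T s p q + 1 ≤ L.rewards.scale := by omega
  have h'' : ((∑ q, L.rewards.T s p q + 1 : ℕ) : ℝ) ≤ L.rewards.scale := Nat.cast_le.2 h'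
  push_cast at h''
  linarith

/-- The total reward is at most that of halting at once, and it is not positive if no legal
sequence of instructions halts. Both bounds are stated up to the weight that is left after `n`
steps. The point is that a violation costs at least one, more than what can be gained later. -/
theorem total_le_of_not_halts [Fintype S] {X : (ℕ → S) → ι × ι → ℝ}
    (hb : ∀ w i, |X w i| ≤ 1)
    (hX : ∀ w i, X w i = (∑ j, (L.rewards.T (w 0) i j : ℝ) * X (fun k => w (k + 1)) j +
      L.rewards.r (w 0) i) / L.rewards.scale)
    (h1 : ∀ s y, L.next s y L.one = y L.one)
    (n : ℕ) (y : ι → ℕ) (hy : y L.one = 1) (w : ℕ → S) :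
    ∑ p, (square y p : ℝ) * X w p ≤ 1 / L.rewards.scale +
        ((L.rewards.scale - 1) / L.rewards.scale : ℝ) ^ n * ((∑ p, square y p : ℕ) : ℝ) ∧
    (¬ L.Halts y → ∑ p, (square y p : ℝ) * X w p ≤
        ((L.rewards.scale - 1) / L.rewards.scale : ℝ) ^ n * ((∑ p, square y p : ℕ) : ℝ)) := by
  have hD : (2 : ℝ) ≤ L.rewards.scale := by exact_mod_cast L.rewards.two_le_scale
  have hD0 : (0 : ℝ) < L.rewards.scale := by linarith
  have hD1 : 1 / (L.rewards.scale : ℝ) ≤ 1 := (div_le_one hD0).2 (by linarith)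
  have hD2 : 0 ≤ 1 / (L.rewards.scale : ℝ) := by positivity
  induction n generalizing y w with
  | zero =>
    have := total_le hb y w
    rw [pow_zero, one_mul]
    exact ⟨by linarith, fun _ => this⟩
  | succ n ih =>
    have hn : L.next (w 0) y L.one = 1 := by rw [h1, hy]
    obtain ⟨ih1, ih2⟩ := ih (L.next (w 0) y) hn fun k => w (k + 1)
    have hρ : 0 ≤ ((L.rewards.scale - 1) / L.rewards.scale : ℝ) :=
      div_nonneg (by linarith) hD0.le
    have hM : ∀ m : ℕ, 0 ≤ ((L.rewards.scale - 1) / L.rewards.scale : ℝ) ^ m *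
        ((∑ p, square y p : ℕ) : ℝ) := fun m => by positivity
    have hT : 0 ≤ ∑ k, (L.testValue (w 0) y k : ℝ) ^ 2 := by positivity
    have hT' : ¬ L.Legal (w 0) y → 1 ≤ ∑ k, (L.testValue (w 0) y k : ℝ) ^ 2 := by
      intro h
      have hz : 0 < ∑ k, L.testValue (w 0) y k ^ 2 := by
        refine (Finset.sum_nonneg fun k _ => sq_nonneg _).lt_of_ne fun h0 => h fun k => ?_
        have := (Finset.sum_eq_zero_iff_of_nonneg fun k _ => sq_nonneg _).1 h0.symm k
          (Finset.mem_univ k)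
        exact pow_eq_zero_iff two_ne_zero |>.1 this
      exact_mod_cast hz
    rw [L.total_succ hX y w, div_le_iff₀ hD0, div_le_iff₀ hD0, add_mul, one_div_mul_cancel hD0.ne']
    by_cases hs : L.halt (w 0) = true
    · simp only [hs, if_true, hy, Nat.cast_one, one_pow, add_zero]
      have := mul_nonneg (hM (n + 1)) hD0.le
      refine ⟨by linarith, fun hh => ?_⟩
      have := hT' fun hl => hh (Halts.halt hl hs)
      linarith
    · simp only [hs, if_false, zero_sub, Bool.false_eq_true]
      have hs' : L.halt (w 0) = false := by simpa using hs
      have hnext : ((L.rewards.scale - 1) / L.rewards.scale : ℝ) ^ n *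
          ((∑ p, square (L.next (w 0) y) p : ℕ) : ℝ) ≤
          ((L.rewards.scale - 1) / L.rewards.scale : ℝ) ^ (n + 1) *
            ((∑ p, square y p : ℕ) : ℝ) * L.rewards.scale := by
        refine (mul_le_mul_of_nonneg_left (L.sum_square_next_le hs' y) (by positivity)).trans
          (le_of_eq ?_)
        rw [pow_succ]
        field_simp
      refine ⟨by linarith, fun hh => ?_⟩
      by_cases hl : L.Legal (w 0) y
      · have := ih2 fun h => hh (Halts.step hl hs' h)
        linarith
      · have := hT' hl
        linarith

theorem exists_total_pos [Fintype S] {X : (ℕ → S) → ι × ι → ℝ}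
    (hX : ∀ w i, X w i = (∑ j, (L.rewards.T (w 0) i j : ℝ) * X (fun k => w (k + 1)) j +
      L.rewards.r (w 0) i) / L.rewards.scale)
    (h1 : ∀ s y, L.next s y L.one = y L.one)
    {y : ι → ℕ} (h : L.Halts y) (hy : y L.one = 1) :
    ∃ w, 0 < ∑ p, (square y p : ℝ) * X w p := by
  have hD : (2 : ℝ) ≤ L.rewards.scale := by exact_mod_cast L.rewards.two_le_scale
  have hD0 : (0 : ℝ) < L.rewards.scale := by linarith
  induction h with
  | @halt s y hl hs =>
    refine ⟨fun _ => s, ?_⟩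
    rw [L.total_succ hX]
    simp only [hs, if_true, hy, show ∀ k, L.testValue s y k = 0 from hl]
    simpa using L.rewards.two_le_scale.trans_lt' two_pos
  | @step s y hl hs _ ih =>
    obtain ⟨w, hw⟩ := ih (by rw [h1, hy])
    refine ⟨fun k => Nat.casesOn k s w, ?_⟩
    rw [L.total_succ hX]
    have hl' : ∀ k, L.testValue s y k = 0 := hl
    change 0 < ((if L.halt s then _ else _) - ∑ k, (L.testValue s y k : ℝ) ^ 2 +
      (if L.halt s then _ else ∑ p, (square (L.next s y) p : ℝ) * X w p)) / _
    simpa [hs, hl'] using div_pos hw hD0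

/-- Some word is accepted with probability greater than `1 / 8` by the automaton that realizes the
reward system of a linear register machine if and only if the machine can halt. -/
theorem existence_iff_halts [Fintype S] [Nonempty S]
    (h1 : ∀ s y, L.next s y L.one = y L.one) {y : ι → ℕ} (hy : y L.one = 1)
    (hY : 0 < ∑ p, square y p) :
    (L.rewards.presentation (square y) hY).Existence (1 / 8) ↔ L.Halts y := by
  obtain ⟨X, hb, hX, h⟩ := L.rewards.presentation_spec hY
  rw [h]
  refine ⟨fun ⟨w, hw⟩ => ?_, fun h => L.exists_total_pos hX h1 h hy⟩
  by_contra hh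
  have hD : (2 : ℝ) ≤ L.rewards.scale := by exact_mod_cast L.rewards.two_le_scale
  have hlim : Tendsto (fun n : ℕ => ((L.rewards.scale - 1) / L.rewards.scale : ℝ) ^ n *
      ((∑ p, square y p : ℕ) : ℝ)) atTop (𝓝 0) := by
    rw [← zero_mul ((∑ p, square y p : ℕ) : ℝ)]
    refine (tendsto_pow_atTop_nhds_zero_of_lt_one (div_nonneg (by linarith) (by linarith))
      ((div_lt_one (by linarith)).2 (by linarith))).mul_const _
  exact hw.not_ge (ge_of_tendsto' hlim fun n =>
    (L.total_le_of_not_halts hb hX h1 n y hy w).2 hh)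

theorem sum_square_pos {y : ι → ℕ} (hy : y L.one = 1) : 0 < ∑ p, square y p := by
  have h : 0 < ∑ i, y i :=
    Finset.sum_pos' (fun _ _ => Nat.zero_le _) ⟨L.one, Finset.mem_univ _, by omega⟩
  rw [sum_square]
  exact Nat.mul_pos h h

end LinearMachine

end Machines

/-! ### Simulation of Turing machines -/

section Simulation

open Turing

namespace TapeMachine

section Digits

variable {Γ : Type} [Inhabited Γ] [Fintype Γ]

open Classical in
/-- An injective numbering of the tape alphabet that sends the blank to `0`. -/
noncomputable def digit (a : Γ) : ℕ :=
  if a = default then 0 else (Fintype.equivFin Γ a : ℕ) + 1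

/-- The base in which the two halves of the tape are read as numbers. -/
def base (Γ : Type) [Fintype Γ] : ℕ :=
  Fintype.card Γ + 1

theorem digit_lt_base (a : Γ) : digit a < base Γ := by
  have := (Fintype.equivFin Γ a).isLt
  unfold digit base
  split_ifs <;> omega

theorem digit_default : digit (default : Γ) = 0 := by
  simp [digit]

theorem digit_injective : Function.Injective (digit : Γ → ℕ) := by
  intro a b h
  unfold digit at h
  split_ifs at h with ha hb hb
  · exact ha.trans hb.symm
  · exact (Fintype.equivFin Γ).injective (Fin.ext (by omega))

/-- The number whose digits are the symbols of a list, the first one being the least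
significant. -/
noncomputable def listCode (l : List Γ) : ℕ :=
  l.foldr (fun a n => digit a + base Γ * n) 0

theorem listCode_append_blanks (l : List Γ) (n : ℕ) :
    listCode (l ++ List.replicate n default) = listCode l := by
  induction l with
  | nil =>
    induction n with
    | zero => rfl
    | succ n ih =>
      simp only [List.nil_append, List.replicate_succ, listCode, List.foldr_cons,
        digit_default] at ih ⊢
      rw [ih]
      simp
  | cons a l ih =>
    simp only [listCode, List.cons_append, List.foldr_cons] at ih ⊢
    rw [ih]

/-- The number whose digits are the symbols on one half of the tape. -/
noncomputable def tapeCode (L : ListBlank Γ) : ℕ :=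
  L.liftOn listCode fun a b ⟨n, h⟩ => by rw [h, listCode_append_blanks]

theorem tapeCode_cons (a : Γ) (L : ListBlank Γ) :
    tapeCode (L.cons a) = digit a + base Γ * tapeCode L := by
  induction L using ListBlank.induction_on with
  | _ l => rfl

theorem tapeCode_eq (L : ListBlank Γ) :
    tapeCode L = digit L.head + base Γ * tapeCode L.tail := by
  rw [← tapeCode_cons, ListBlank.cons_head_tail]

/-- The test by which a linear machine removes a digit: division with remainder is unique. -/
theorem digit_test_iff (L : ListBlank Γ) (a : Γ) (t : ℕ) :
    tapeCode L = digit a + base Γ * t ↔ a = L.head ∧ t = tapeCode L.tail := by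
  rw [tapeCode_eq]
  constructor
  · intro h
    have hm := congrArg (· % base Γ) h
    have hd := congrArg (· / base Γ) h
    have hB : 0 < base Γ := Nat.succ_pos _
    simp only [Nat.add_mul_mod_self_left, Nat.mod_eq_of_lt (digit_lt_base _)] at hm
    simp only [Nat.add_mul_div_left _ _ hB, Nat.div_eq_of_lt (digit_lt_base _), zero_add] at hd
    exact ⟨(digit_injective hm).symm, hd.symm⟩
  · rintro ⟨rfl, rfl⟩
    rfl

end Digits

section Control

variable {Γ Λ : Type} [Fintype Γ] [Fintype Λ]

/-- An injective numbering of the pairs of a label and a symbol under the head. -/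
noncomputable def control (q : Λ) (a : Γ) : ℕ :=
  Fintype.equivFin (Λ × Γ) (q, a)

theorem control_inj {q q' : Λ} {a a' : Γ} : control q a = control q' a' ↔ q = q' ∧ a = a' := by
  rw [control, control, Fin.val_inj, (Fintype.equivFin (Λ × Γ)).injective.eq_iff, Prod.mk.injEq]

end Control

theorem step_eq_none_iff {Γ Λ : Type} [Inhabited Γ] [Inhabited Λ] (M : TM0.Machine Γ Λ)
    (c : TM0.Cfg Γ Λ) : TM0.step M c = none ↔ M c.q c.Tape.head = none := by
  obtain ⟨q, T⟩ := c
  simp [TM0.step]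

variable {Γ Λ : Type} [Inhabited Γ] [Fintype Γ] [Inhabited Λ] [Fintype Λ]

/-- The coefficients of the linear update of each register. The five registers are: the constant
one, the control register, the left and the right half of the tape, and a scratch register. The
instruction `none` increments the scratch register. The instruction `some (q, a, b)` executes the
step of the Turing machine with label `q` and head symbol `a`; if the head moves, `b` is the guess
of the next symbol under the head, and the scratch register is the guess of the rest of the half
tape from which `b` is taken. -/
noncomputable def updates (M : TM0.Machine Γ Λ) : Option (Λ × Γ × Γ) → Fin 5 → Fin 5 → ℕ
  | none => ![![1, 0, 0, 0, 0], ![0, 1, 0, 0, 0], ![0, 0, 1, 0, 0], ![0, 0, 0, 1, 0],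
      ![1, 0, 0, 0, 1]]
  | some (q, a, b) =>
    match M q a with
    | none => ![![1, 0, 0, 0, 0], 0, 0, 0, 0]
    | some (q', TM0.Stmt.write c) => ![![1, 0, 0, 0, 0], ![control q' c, 0, 0, 0, 0],
        ![0, 0, 1, 0, 0], ![0, 0, 0, 1, 0], 0]
    | some (q', TM0.Stmt.move Dir.left) => ![![1, 0, 0, 0, 0], ![control q' b, 0, 0, 0, 0],
        ![0, 0, 0, 0, 1], ![digit a, 0, 0, base Γ, 0], 0]
    | some (q', TM0.Stmt.move Dir.right) => ![![1, 0, 0, 0, 0], ![control q' b, 0, 0, 0, 0],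
        ![digit a, 0, base Γ, 0, 0], ![0, 0, 0, 0, 1], 0]

/-- The tests of the instructions: the control register has to be right, and so has the guess of
the next symbol under the head together with the rest of the half tape. -/
noncomputable def tests (M : TM0.Machine Γ Λ) : Option (Λ × Γ × Γ) → Fin 2 → Fin 5 → ℤ
  | none => 0
  | some (q, a, b) => ![![-control q a, 1, 0, 0, 0],
    match M q a with
    | none => 0
    | some (_, TM0.Stmt.write _) => 0
    | some (_, TM0.Stmt.move Dir.left) => ![-digit b, 0, 1, 0, -base Γ]
    | some (_, TM0.Stmt.move Dir.right) => ![-digit b, 0, 0, 1, -base Γ]]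

/-- The linear register machine that simulates a Turing machine. -/
noncomputable def toLinear (M : TM0.Machine Γ Λ) :
    LinearMachine (Option (Λ × Γ × Γ)) (Fin 5) where
  upd s i j := updates M s j i
  test := tests M
  halt s := s.elim false fun p => (M p.1 p.2.1).isNone
  one := 0

/-- The registers that represent a configuration of a Turing machine, with scratch register `t`. -/
noncomputable def registers (c : TM0.Cfg Γ Λ) (t : ℕ) : Fin 5 → ℕ :=
  ![1, control c.q c.Tape.head, tapeCode c.Tape.left, tapeCode c.Tape.right, t]

theorem registers_init_cons (a : Γ) (l : List Γ) :
    registers (TM0.init (a :: l) : TM0.Cfg Γ Λ) 0 =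
      ![1, control (default : Λ) a, 0, listCode l, 0] :=
  rfl

variable (M : TM0.Machine Γ Λ)

theorem next_one (s : Option (Λ × Γ × Γ)) (y : Fin 5 → ℕ) :
    (toLinear M).next s y (toLinear M).one = y (toLinear M).one := by
  have h : updates M s 0 = ![1, 0, 0, 0, 0] := by
    rcases s with _ | ⟨q, a, b⟩
    · rfl
    · rcases h : M q a with _ | ⟨q', (_ | _) | c⟩ <;> simp [updates, h]
  simp [LinearMachine.next, toLinear, h, Fin.sum_univ_succ]

theorem legal_none (y : Fin 5 → ℕ) : (toLinear M).Legal none y := by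
  intro k
  simp [LinearMachine.testValue, toLinear, tests]

theorem next_none (c : TM0.Cfg Γ Λ) (t : ℕ) :
    (toLinear M).next none (registers c t) = registers c (t + 1) := by
  funext j
  fin_cases j <;>
    simp [LinearMachine.next, toLinear, updates, registers, Fin.sum_univ_succ, add_comm]

theorem halts_of_halts_add (c : TM0.Cfg Γ Λ) (t n : ℕ)
    (h : (toLinear M).Halts (registers c (t + n))) : (toLinear M).Halts (registers c t) := by
  induction n with
  | zero => exact h
  | succ n ih =>
    refine ih (LinearMachine.Halts.step (s := none) (legal_none M _) rfl ?_)
    rw [next_none]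
    exact h

theorem control_test_iff (q : Λ) (a b : Γ) (c : TM0.Cfg Γ Λ) (t : ℕ) :
    (toLinear M).testValue (some (q, a, b)) (registers c t) 0 = 0 ↔
      c.q = q ∧ c.Tape.head = a := by
  rw [← control_inj]
  simp [LinearMachine.testValue, toLinear, tests, registers, Fin.sum_univ_succ]
  omega

/-- A legal instruction other than incrementing the scratch register is the one that the Turing
machine executes, with correct guesses, and leads to the next configuration. -/
theorem legal_some_iff (q : Λ) (a b : Γ) (c : TM0.Cfg Γ Λ) (t : ℕ) :
    (toLinear M).Legal (some (q, a, b)) (registers c t) ↔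
      c.q = q ∧ c.Tape.head = a ∧
        match M q a with
        | none => True
        | some (_, TM0.Stmt.write _) => True
        | some (_, TM0.Stmt.move Dir.left) =>
          b = c.Tape.left.head ∧ t = tapeCode c.Tape.left.tail
        | some (_, TM0.Stmt.move Dir.right) =>
          b = c.Tape.right.head ∧ t = tapeCode c.Tape.right.tail := by
  rw [LinearMachine.Legal, Fin.forall_fin_two, control_test_iff, and_assoc]
  refine and_congr_right fun _ => and_congr_right fun _ => ?_
  rcases h : M q a with _ | ⟨q', (_ | _) | c'⟩
  · simp [LinearMachine.testValue, toLinear, tests, h]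
  · simp only
    rw [← digit_test_iff]
    simp [LinearMachine.testValue, toLinear, tests, h, registers, Fin.sum_univ_succ]
    zify
    constructor <;> intro h' <;> linarith
  · simp only
    rw [← digit_test_iff]
    simp [LinearMachine.testValue, toLinear, tests, h, registers, Fin.sum_univ_succ]
    zify
    constructor <;> intro h' <;> linarith
  · simp [LinearMachine.testValue, toLinear, tests, h]

theorem next_some {q : Λ} {a b : Γ} {c c' : TM0.Cfg Γ Λ} {t : ℕ}
    (hl : (toLinear M).Legal (some (q, a, b)) (registers c t)) (hc : TM0.step M c = some c') :
    (toLinear M).next (some (q, a, b)) (registers c t) = registers c' 0 := by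
  rw [legal_some_iff] at hl
  obtain ⟨q₀, ⟨h, L, R⟩⟩ := c
  obtain ⟨rfl, rfl, hl⟩ := hl
  simp only [TM0.step] at hc hl
  rcases hM : M q₀ h with _ | ⟨q', (_ | _) | x⟩
  · simp [hM] at hc
  · simp only [hM, Option.map_some, Option.some.injEq] at hc hl
    subst hc
    obtain ⟨rfl, rfl⟩ := hl
    funext j
    fin_cases j <;> simp [LinearMachine.next, toLinear, updates, hM, registers,
      Fin.sum_univ_succ, Tape.move, tapeCode_cons, mul_comm]
  · simp only [hM, Option.map_some, Option.some.injEq] at hc hl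
    subst hc
    obtain ⟨rfl, rfl⟩ := hl
    funext j
    fin_cases j <;> simp [LinearMachine.next, toLinear, updates, hM, registers,
      Fin.sum_univ_succ, Tape.move, tapeCode_cons, mul_comm]
  · simp only [hM, Option.map_some, Option.some.injEq] at hc hl
    subst hc
    funext j
    fin_cases j <;> simp [LinearMachine.next, toLinear, updates, hM, registers,
      Fin.sum_univ_succ, Tape.write]

theorem reaches_of_halts {y : Fin 5 → ℕ} (h : (toLinear M).Halts y) (c : TM0.Cfg Γ Λ) (t : ℕ)
    (hy : y = registers c t) :
    ∃ b, StateTransition.Reaches (TM0.step M) c b ∧ TM0.step M b = none := by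
  induction h generalizing c t with
  | @halt s y hl hs =>
    subst hy
    rcases s with _ | ⟨q, a, b⟩
    · simp [toLinear] at hs
    · obtain ⟨rfl, rfl, -⟩ := (legal_some_iff M q a b c t).1 hl
      exact ⟨c, Relation.ReflTransGen.refl, (step_eq_none_iff M c).2 (by simpa [toLinear] using hs)⟩
  | @step s y hl hs _ ih =>
    subst hy
    rcases s with _ | ⟨q, a, b⟩
    · exact ih c (t + 1) (next_none M c t)
    · obtain ⟨rfl, rfl, -⟩ := (legal_some_iff M q a b c t).1 hl
      rcases hc : TM0.step M c with _ | c'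
      · rw [step_eq_none_iff] at hc
        simp [toLinear, hc] at hs
      · obtain ⟨d, hd, hd'⟩ := ih c' 0 (next_some M hl hc)
        exact ⟨d, Relation.ReflTransGen.head hc hd, hd'⟩

theorem halts_of_reaches {c d : TM0.Cfg Γ Λ} (h : StateTransition.Reaches (TM0.step M) c d)
    (hd : TM0.step M d = none) : (toLinear M).Halts (registers c 0) := by
  induction h using Relation.ReflTransGen.head_induction_on with
  | refl =>
    rw [step_eq_none_iff] at hd
    refine LinearMachine.Halts.halt (s := some (d.q, d.Tape.head, default)) ?_ ?_
    · simp [legal_some_iff, hd]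
    · simp [toLinear, hd]
  | @head c e hce _ ih =>
    have hc : M c.q c.Tape.head ≠ none := fun h => by
      rw [(step_eq_none_iff M c).2 h] at hce
      simp at hce
    obtain ⟨b, t, hl⟩ : ∃ b t, (toLinear M).Legal (some (c.q, c.Tape.head, b)) (registers c t) := by
      simp only [legal_some_iff, true_and]
      rcases h : M c.q c.Tape.head with _ | ⟨q', (_ | _) | x⟩
      · exact absurd h hc
      · exact ⟨_, _, rfl, rfl⟩
      · exact ⟨_, _, rfl, rfl⟩
      · exact ⟨default, 0, trivial⟩
    refine halts_of_halts_add M c 0 t ?_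
    rw [zero_add]
    refine LinearMachine.Halts.step hl ?_ ?_
    · simpa [toLinear, Option.isNone_iff_eq_none] using Option.ne_none_iff_isSome.1 hc
    · rw [next_some M hl hce]
      exact ih

/-- The linear machine halts when started from the registers that represent a configuration if and
only if the Turing machine halts when started from this configuration. -/
theorem halts_iff_eval_dom (c : TM0.Cfg Γ Λ) :
    (toLinear M).Halts (registers c 0) ↔ (StateTransition.eval (TM0.step M) c).Dom := by
  rw [Part.dom_iff_mem]
  simp only [StateTransition.mem_eval]
  exact ⟨fun h => reaches_of_halts M h c 0 rfl, fun ⟨d, hd, hd'⟩ => halts_of_reaches M hd hd'⟩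

end TapeMachine

end Simulation

/-! ### A universal Turing machine -/

section Universal

open Turing

/-- A Turing machine with finitely many reachable labels can be replaced by one with finitely many
labels. -/
theorem Turing.TM0.exists_fintype_labels {Γ Λ : Type} [Inhabited Γ] [Inhabited Λ]
    (M : TM0.Machine Γ Λ) (F : Finset Λ) (h : TM0.Supports M (F : Set Λ)) :
    ∃ (Λ' : Type) (_ : Inhabited Λ') (_ : Fintype Λ') (M' : TM0.Machine Γ Λ'),
      ∀ l : List Γ, (StateTransition.eval (TM0.step M') (TM0.init l)).Dom ↔
        (TM0.eval M l).Dom := by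
  classical
  let i : Inhabited F := ⟨⟨default, h.1⟩⟩
  let f : PointedMap Γ Γ := ⟨id, rfl⟩
  let g₁ : PointedMap Λ F := ⟨fun q => if hq : q ∈ F then ⟨q, hq⟩ else default,
    dif_pos (Finset.mem_coe.1 h.1)⟩
  refine ⟨F, i, inferInstance, M.map f f g₁ Subtype.val, fun l => ?_⟩
  have hr := TM0.Machine.map_respects M f f g₁ Subtype.val h (fun _ => rfl) fun q hq => by
    change ((if hq : q ∈ F then ⟨q, hq⟩ else default : F) : Λ) = q
    rw [dif_pos (by exact hq)]
  refine StateTransition.tr_eval_dom hr (a₁ := TM0.init l) ⟨h.1, ?_⟩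
  rw [TM0.map_init]
  exact congrArg TM0.init (List.map_id l)

open PartrecToTM2 in
theorem Turing.PartrecToTM2.trNat_of_pos {n : ℕ} (hn : 0 < n) :
    trNat n = (if n % 2 = 0 then Γ'.bit0 else Γ'.bit1) :: trNat (n / 2) := by
  have hp : ∀ p : PosNum, trNat (p : ℕ) = trPosNum p := fun p => by
    rw [trNat, PosNum.of_to_nat]
    rfl
  obtain ⟨p, rfl⟩ : ∃ p : PosNum, n = p := by
    have h := Num.to_of_nat n
    rcases hN : (n : Num) with _ | p
    · rw [hN] at h
      exact absurd h (by simpa using hn.ne)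
    · rw [hN] at h
      exact ⟨p, h.symm⟩
  rw [hp]
  rcases p with _ | p | p
  · simp [trPosNum]
  · have h1 : ((p.bit1 : PosNum) : ℕ) = p + p + 1 := rfl
    rw [h1, show ((p : ℕ) + p + 1) % 2 = 1 by omega, show ((p : ℕ) + p + 1) / 2 = p by omega, hp]
    rfl
  · have h1 : ((p.bit0 : PosNum) : ℕ) = p + p := rfl
    rw [h1, show ((p : ℕ) + p) % 2 = 0 by omega, show ((p : ℕ) + p) / 2 = p by omega, hp]
    rfl

open PartrecToTM2 in
/-- The reversed binary expansion of `n`, read in a base `B` with arbitrary digits, depends on `n`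
in a primitive recursive way. -/
theorem primrec_foldr_trNat_reverse (φ : PartrecToTM2.Γ' → ℕ) (B : ℕ) :
    Primrec fun n => (trNat n).reverse.foldr (fun a m => φ a + B * m) 0 := by
  let val : ℕ → ℕ := fun n => (trNat n).reverse.foldr (fun a m => φ a + B * m) 0
  -- the power of `B` has to be computed alongside, as the last digit is the leading one
  let F : Unit → ℕ → ℕ × ℕ := fun _ n => (val n, B ^ (trNat n).length)
  have happ : ∀ (l : List PartrecToTM2.Γ') (c : ℕ),
      l.foldr (fun a m => φ a + B * m) c =
        l.foldr (fun a m => φ a + B * m) 0 + B ^ l.length * c := by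
    intro l c
    induction l with
    | nil => simp
    | cons a l ih =>
      simp only [List.foldr_cons, List.length_cons]
      rw [ih]
      ring
  let G : Unit → List (ℕ × ℕ) → Option (ℕ × ℕ) := fun _ L =>
    if L.length = 0 then some (0, 1) else
      (L[L.length / 2]?).map fun p =>
        (p.1 + p.2 * (if L.length % 2 = 0 then φ Γ'.bit0 else φ Γ'.bit1), B * p.2)
  have hlen : Primrec fun x : Unit × List (ℕ × ℕ) => x.2.length :=
    Primrec.list_length.comp Primrec.snd
  have hG : Primrec₂ G := by
    refine Primrec.ite (Primrec.eq.comp hlen (Primrec.const 0)) (Primrec.const _)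
      (Primrec.option_map (Primrec.list_getElem?.comp Primrec.snd
        (Primrec.nat_div.comp hlen (Primrec.const 2))) ?_)
    have h2 : Primrec fun x : (Unit × List (ℕ × ℕ)) × (ℕ × ℕ) => x.1.2.length :=
      hlen.comp Primrec.fst
    refine Primrec.pair (Primrec.nat_add.comp (Primrec.fst.comp Primrec.snd)
      (Primrec.nat_mul.comp (Primrec.snd.comp Primrec.snd) (Primrec.ite ?_ (Primrec.const _)
        (Primrec.const _)))) (Primrec.nat_mul.comp (Primrec.const B)
          (Primrec.snd.comp Primrec.snd))
    exact Primrec.eq.comp (Primrec.nat_mod.comp h2 (Primrec.const 2)) (Primrec.const 0)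
  have hF : Primrec₂ F := by
    refine Primrec.nat_strong_rec F hG fun _ n => ?_
    rcases Nat.eq_zero_or_pos n with rfl | hn
    · simp [G, F, val]
    · have hlt : n / 2 < n := Nat.div_lt_self hn one_lt_two
      simp only [G, List.length_map, List.length_range, hn.ne', if_false, F, val]
      rw [List.getElem?_map, List.getElem?_range hlt, trNat_of_pos hn]
      simp only [Option.map_some, List.reverse_cons, List.foldr_append, List.foldr_cons,
        List.foldr_nil, mul_zero, add_zero, List.length_cons, Option.some.injEq, Prod.mk.injEq]
      rw [happ _ (φ _), List.length_reverse]
      refine ⟨?_, (pow_succ' _ _).symm⟩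
      split_ifs <;> rfl
  exact Primrec.fst.comp (hF.comp (Primrec.const ()) Primrec.id)

/-- The tape symbol that holds the symbol `a` of the main stack and nothing of the other stacks;
`b` says whether this is the bottom of the stacks. -/
def Turing.PartrecToTM2.mainSymbol (b : Bool) (a : PartrecToTM2.Γ') :
    TM2to1.Γ' PartrecToTM2.K' fun _ => PartrecToTM2.Γ' :=
  (b, Function.update (fun _ => none) PartrecToTM2.K'.main (some a))

open PartrecToTM2 in
theorem Turing.PartrecToTM2.trInit_trList_singleton (n : ℕ) :
    TM2to1.trInit K'.main (trList [n]) =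
      mainSymbol true Γ'.cons :: (trNat n).reverse.map (mainSymbol false) := by
  have hr : (trList [n]).reverse = Γ'.cons :: (trNat n).reverse := by simp
  unfold TM2to1.trInit
  rw [hr]
  rfl

/-- There are a Turing machine with finitely many labels and symbols and inputs `l n` for it such
that halting on `l n` is undecidable, while the numbers that represent the initial configuration
depend on `n` in a primitive recursive way. -/
theorem exists_universal_machine :
    ∃ (Γ Λ : Type) (_ : Inhabited Γ) (_ : Fintype Γ) (_ : Inhabited Λ) (_ : Fintype Λ)
      (M : TM0.Machine Γ Λ) (l : ℕ → List Γ),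
      (¬ ComputablePred fun n => (StateTransition.eval (TM0.step M) (TM0.init (l n))).Dom) ∧
      ∀ i, Primrec fun n =>
        TapeMachine.registers (TM0.init (l n) : TM0.Cfg Γ Λ) 0 i := by
  classical
  -- a code that on input `n` runs the `n`-th partial recursive function on the input `0`
  have hf : Partrec fun n : ℕ => (Denumerable.ofNat Nat.Partrec.Code n).eval 0 :=
    Nat.Partrec.Code.eval_part.comp (Computable.ofNat _) (Computable.const 0)
  obtain ⟨c, hc⟩ := ToPartrec.Code.exists_code (Nat.Partrec'.part_iff₁.2 hf)
  let iΛ : Inhabited PartrecToTM2.Λ' :=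
    ⟨PartrecToTM2.trNormal c PartrecToTM2.Cont'.halt⟩
  let iK : Fintype PartrecToTM2.K' :=
    ⟨{PartrecToTM2.K'.main, PartrecToTM2.K'.rev, PartrecToTM2.K'.aux, PartrecToTM2.K'.stack},
      fun k => by cases k <;> simp⟩
  have h2 := PartrecToTM2.tr_supports c PartrecToTM2.Cont'.halt
  have h1 := TM2to1.tr_supports PartrecToTM2.tr h2
  have h0 := TM1to0.tr_supports _ h1
  obtain ⟨Λ, _, _, M, hM⟩ := TM0.exists_fintype_labels _ _ h0
  refine ⟨TM2to1.Γ' PartrecToTM2.K' fun _ => PartrecToTM2.Γ', Λ, inferInstance, inferInstance,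
    inferInstance, inferInstance, M,
    fun n => TM2to1.trInit PartrecToTM2.K'.main (PartrecToTM2.trList [n]), ?_, ?_⟩
  · have hdom : ∀ n, (StateTransition.eval (TM0.step M) (TM0.init
        (TM2to1.trInit PartrecToTM2.K'.main (PartrecToTM2.trList [n])))).Dom ↔
        ((Denumerable.ofNat Nat.Partrec.Code n).eval 0).Dom := by
      intro n
      rw [hM, TM1to0.tr_eval]
      refine (TM2to1.tr_eval_dom _ _ _).trans ?_
      have hi : (TM2.init PartrecToTM2.K'.main (PartrecToTM2.trList [n]) :
          TM2.Cfg (fun _ : PartrecToTM2.K' => PartrecToTM2.Γ') PartrecToTM2.Λ'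
            (Option PartrecToTM2.Γ')) = PartrecToTM2.init c [n] := by
        simp only [TM2.init, PartrecToTM2.init]
        congr 1
        funext k
        cases k <;> rfl
      change (StateTransition.eval (TM2.step PartrecToTM2.tr) (TM2.init _ _)).Dom ↔ _
      rw [hi, PartrecToTM2.tr_eval]
      have := hc ⟨[n], rfl⟩
      change (ToPartrec.Code.eval c [n]).Dom ↔ _
      rw [this]
      rfl
    simp only [hdom]
    intro h
    refine ComputablePred.halting_problem 0 ?_
    have := ComputablePred.computable_iff.1 h
    obtain ⟨g, hg, hgp⟩ := this
    refine ComputablePred.computable_iff.2 ⟨fun c => g (Encodable.encode c),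
      hg.comp Computable.encode, ?_⟩
    funext c
    have := congrFun hgp (Encodable.encode c)
    simpa using this
  · intro i
    simp only [PartrecToTM2.trInit_trList_singleton, TapeMachine.registers_init_cons]
    fin_cases i
    · exact Primrec.const 1
    · exact Primrec.const (TapeMachine.control (default : Λ) _)
    · exact Primrec.const 0
    · refine (primrec_foldr_trNat_reverse
        (fun a => TapeMachine.digit (PartrecToTM2.mainSymbol false a))
        (TapeMachine.base (TM2to1.Γ' PartrecToTM2.K' fun _ => PartrecToTM2.Γ'))).of_eq fun n => ?_
      change _ = TapeMachine.listCode _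
      rw [TapeMachine.listCode, List.foldr_map]
    · exact Primrec.const 0

end Universal

/-! ### Undecidability -/

section Undecidability

open Turing

/-- Deciding the existence problem for the threshold `1 / 8` would decide the halting of a universal
Turing machine, as only the initial transition probabilities depend on the input of the
machine. -/
theorem not_decidable_existence :
    ¬ DecidableProblem (fun P : AbsorbingSafety => P.1.code) (fun P => P.1.Existence (1 / 8)) := by
  rintro ⟨f, hf, hfy⟩
  obtain ⟨Γ, Λ, _, _, _, _, M, l, hl, hp⟩ := exists_universal_machine
  refine hl ?_
  let L := TapeMachine.toLinear M
  let y : ℕ → Fin 5 → ℕ := fun n => TapeMachine.registers (TM0.init (l n) : TM0.Cfg Γ Λ) 0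
  have hy : ∀ n, y n L.one = 1 := fun n => rfl
  have hY := fun n => L.sum_square_pos (hy n)
  let P : ℕ → AbsorbingSafety := fun n =>
    ⟨L.rewards.presentation (LinearMachine.square (y n)) (hY n),
      L.rewards.presentation_isAbsorbing (hY n)⟩
  have hcode : Computable fun n => (P n).1.code :=
    (L.rewards.primrec_presentation_code (Y := fun n => LinearMachine.square (y n)) hY
      fun p => Primrec.nat_mul.comp (hp p.1) (hp p.2)).to_comp
  refine ComputablePred.computable_iff.2 ⟨fun n => f (P n).1.code, hf.comp hcode, ?_⟩
  funext n
  refine propext (Iff.trans ?_ (hfy (P n)).symm)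
  change _ ↔ (L.rewards.presentation (LinearMachine.square (y n)) (hY n)).Existence (1 / 8)
  rw [L.existence_iff_halts (TapeMachine.next_one M) (hy n) (hY n),
    TapeMachine.halts_iff_eval_dom]

end Undecidability

theorem SafetyPresentation.supValue_iff_existence (P : SafetyPresentation) (r : ℝ) :
    P.SupValue r ↔ P.Existence r := by
  have : Nonempty (Fin P.numLetters) := ⟨⟨0, P.numLetters_pos⟩⟩
  refine lt_ciSup_iff ⟨1, ?_⟩
  rintro _ ⟨w, rfl⟩
  exact MeasureTheory.measureReal_le_one

/-- A problem with a threshold as part of the input is undecidable if it is so for the threshold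
`1 / 8`. -/
theorem not_decidable_of_fixed_threshold (yes : SafetyPresentation → ℝ → Prop)
    (h : ¬ DecidableProblem (fun P : AbsorbingSafety => P.1.code) (fun P => yes P.1 (1 / 8))) :
    ¬ DecidableProblem (fun i : AbsorbingSafety × Threshold => (i.1.1.code, i.2.code))
      (fun i => yes i.1.1 i.2.toReal) := by
  rintro ⟨f, hf, hfy⟩
  refine h ⟨fun c => f (c, (1, 8)), hf.comp (Computable.pair Computable.id (Computable.const _)),
    fun P => ?_⟩
  have := hfy (P, ⟨1, 8, by norm_num, by norm_num⟩)
  simpa [Threshold.code, Threshold.toReal] using this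

theorem theorem2 :
    (¬ DecidableProblem (fun i : AbsorbingSafety × Threshold => (i.1.1.code, i.2.code))
        (fun i => i.1.1.Existence i.2.toReal)) ∧
    (¬ DecidableProblem (fun i : AbsorbingSafety × Threshold => (i.1.1.code, i.2.code))
        (fun i => i.1.1.SupValue i.2.toReal)) ∧
    (¬ DecidableProblem (fun P : AbsorbingSafety => P.1.code)
        (fun P => P.1.Existence (1 / 8))) ∧
    (¬ DecidableProblem (fun P : AbsorbingSafety => P.1.code)
        (fun P => P.1.SupValue (1 / 8))) := by
  have h := not_decidable_existence
  have h' := not_decidable_of_fixed_threshold SafetyPresentation.Existence h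
  simp only [SafetyPresentation.supValue_iff_existence]
  exact ⟨h', h', h, h⟩
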